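/- Let $d,k\ge 0$ be integers with $k\ge 2d$, let $Q\in\mathbb C^{k\times k}$ be an invertible symmetric matrix, identify $\mathbb C^d\otimes\mathbb C^k$ with the space $\mathbb C^{d\times k}$ of complex $d\times k$ matrices, and put $$\mu\colon \mathbb C^{d\times k}\to \operatorname{Sym}_d(\mathbb C),\qquad \mu(X)=XQX^t .$$ Dimensions are those of the Zariski closures in $\mathbb C^{d\times k}$, i.e. Krull dimensions of coordinate rings, with $\dim\emptyset=-\infty$. Then: 1. $\dim\mu^{-1}(0)=kd-\binom{d+1}{2}$. 2. Let $J\in\mathbb C^{d\times d}$ be any invertible skew-symmetric matrix (so $d$ is even), let $Sp_J=\{g\in\mathbb C^{d\times d}\mid g^tJg=J\}$ act on $\mathbb C^{d\times k}$ by left multiplication, and let $N=\{X\in\mu^{-1}(0)\mid \text{the stabiliser of } X \text{ in } Sp_J \text{ is infinite}\}$. Then $\dim N\le kd-\binom{d+1}{2}-1$, and $\dim N\le kd-\binom{d+1}{2}-2$ if $k\ge 2d+1$. 3. For every $d$, even or odd, the same two bounds hold with $N$ replaced by $L=\{X\in\mu^{-1}(0)\mid X^tu=0 \text{ for some } 0\ne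 u\in\mathbb C^d\}$. -/

import Mathlib

open Matrix

namespace SpMoment

/-- The map `X ↦ X Q Xᵗ` on `U ⊗ W`, whose elements are written as matrices with rows indexed
by a basis of `U` and columns indexed by a basis of `W`; `Q` is the Gram matrix of the
orthogonal structure on `W`. -/
def momentMap {ι κ : Type*} [Fintype κ] (Q : Matrix κ κ ℂ) (X : Matrix ι κ ℂ) :
    Matrix ι ι ℂ :=
  X * Q * Xᵀ

/-- The zero fibre of the moment map. -/
def zeroFibre {ι κ : Type*} [Fintype κ] (Q : Matrix κ κ ℂ) : Set (Matrix ι κ ℂ) :=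
  {X | momentMap Q X = 0}

/-- The isotropy group at `X` of the symplectic group of the form with Gram matrix `J`,
acting by multiplication from the left. For invertible `J` every `g` with `gᵗ J g = J` is
invertible. -/
def isotropy {ι κ : Type*} [Fintype ι] (J : Matrix ι ι ℂ) (X : Matrix ι κ ℂ) :
    Set (Matrix ι ι ℂ) :=
  {g | gᵀ * J * g = J ∧ g * X = X}

/-- The locus `N` of points of the zero fibre with infinite isotropy group. -/
def infiniteIsotropyLocus {ι κ : Type*} [Fintype ι] [Fintype κ]
    (J : Matrix ι ι ℂ) (Q : Matrix κ κ ℂ) : Set (Matrix ι κ ℂ) :=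
  {X | X ∈ zeroFibre Q ∧ (isotropy J X).Infinite}

/-- The locus `L` of points `X` of the zero fibre such that the associated linear map
`u ↦ Xᵗ u` from `U` to `W` has a nonzero kernel. -/
def degenerateLocus {ι κ : Type*} [Fintype ι] [Fintype κ] (Q : Matrix κ κ ℂ) :
    Set (Matrix ι κ ℂ) :=
  {X | X ∈ zeroFibre Q ∧ ∃ u : ι → ℂ, u ≠ 0 ∧ Xᵀ *ᵥ u = 0}

/-- The dimension of (the Zariski closure of) a set `S` of complex matrices: the Krull dimension
of the ring of polynomials in the matrix entries modulo the ideal of polynomials vanishing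
on `S`. The empty set has dimension `⊥`. -/
noncomputable def zariskiDim {ι κ : Type*} (S : Set (Matrix ι κ ℂ)) : WithBot ℕ∞ :=
  ringKrullDim (MvPolynomial (ι × κ) ℂ ⧸
    MvPolynomial.vanishingIdeal ℂ ((fun (X : Matrix ι κ ℂ) (p : ι × κ) => X p.1 p.2) '' S))

end SpMoment

namespace SpMoment

/-! ### Dimension theory of affine algebras -/

section KrullDimension

/-! The zero fibre is cut out by one quadric per unordered pair of rows and contains 0, so Krull's
height theorem bounds its dimension from below.

The upper bounds come from counting parameters at the generic point of each irreducible closed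
subset, i.e. of each prime `P`. Over the fraction field `K` of the coordinate ring, the rows of the
generic matrix are isotropic and pairwise orthogonal. Adjoin them one at a time, with `F` the
relative algebraic closure of the parameters used so far and `S` the span of the earlier rows. A row
in the extension of `S` to `K` costs at most dim `S` parameters. Any other row costs at most k - dim
`S` - 1: orthogonality is linear over `F`, and isotropy removes one more parameter because `S`^⊥
contains an anisotropic vector (`exists_parameters_of_notMem_extend`). For generic rank r this gives
at most r(k + d - r) - r(r+1)/2 (`exists_parameters_of_isotropic`).

With e = d - r and m = k - 2d, this falls short of kd - binom(d+1,2) by e(3e + 2m - 1)/2 ≥ e(m + 1).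
On L all maximal minors vanish, so e ≥ 1 there, and N ⊆ L. -/

theorem ringKrullDim_le_of_isIntegral {R A : Type*} [CommRing R] [CommRing A] [Algebra R A]
    [Algebra.IsIntegral R A] : ringKrullDim A ≤ ringKrullDim R :=
  Order.krullDim_le_of_strictMono (PrimeSpectrum.comap (algebraMap R A))
    fun _ _ h => Ideal.IsIntegral.comap_lt_comap (R := R) h

/-- A finitely generated algebra embedded in a field has dimension at most `#T` if its elements
are algebraic over the subalgebra generated by `T`. -/
theorem ringKrullDim_le_card_of_isAlgebraic {k A K : Type*} [Field k] [CommRing A] [Nontrivial A]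
    [Algebra k A] [Algebra.FiniteType k A] [Field K] [Algebra k K] (f : A →ₐ[k] K)
    (hf : Function.Injective f) (T : Finset K)
    (hT : ∀ a, IsAlgebraic (Algebra.adjoin k (T : Set K)) (f a)) :
    ringKrullDim A ≤ T.card := by
  -- Noether normalisation: the dimension is at most `s`, and the `s` variables stay independent in
  -- `K`, inside the matroid closure of `T`.
  obtain ⟨s, g, hg, hint⟩ := exists_integral_inj_algHom_of_fg k A
  have hdim : ringKrullDim A ≤ s := by
    algebraize [g.toRingHom]
    have : Algebra.IsIntegral (MvPolynomial (Fin s) k) A := ⟨hint⟩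
    refine (ringKrullDim_le_of_isIntegral (R := MvPolynomial (Fin s) k)).trans ?_
    rw [MvPolynomial.ringKrullDim_of_isNoetherianRing, ringKrullDim_eq_zero_of_field]
    simp
  refine hdim.trans ?_
  have hz : AlgebraicIndependent k (fun i => (f.comp g) (MvPolynomial.X i)) :=
    (MvPolynomial.algebraicIndependent_X (Fin s) k).map' (f := f.comp g) (hf.comp hg)
  have hind : (AlgebraicIndependent.matroid k K).Indep
      (Set.range fun i => (f.comp g) (MvPolynomial.X i)) :=
    AlgebraicIndependent.matroid_indep_iff.mpr hz.coe_range
  have hcl : (Set.range fun i => (f.comp g) (MvPolynomial.X i)) ⊆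
      (AlgebraicIndependent.matroid k K).closure (T : Set K) := by
    rw [AlgebraicIndependent.matroid_closure_eq]
    rintro _ ⟨i, rfl⟩
    exact hT _
  have hle := hind.encard_le_eRk_of_subset hcl
  rw [Matroid.eRk_closure_eq] at hle
  have hle' := hle.trans (Matroid.eRk_le_encard _ _)
  rw [Set.encard_coe_eq_coe_finsetCard] at hle'
  replace hle' := hz.injective.encard_range.trans hle'
  simp only [ENat.card_eq_coe_fintype_card, Fintype.card_fin] at hle'
  exact_mod_cast hle'

/-- The generic point of a prime ideal `P`: if its coordinates are algebraic over `k[T]`, then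
`V(P)` has dimension at most `#T`. -/
theorem ringKrullDim_quotient_le_card {σ k : Type*} [Finite σ] [Field k]
    (P : Ideal (MvPolynomial σ k)) [P.IsPrime]
    (T : Finset (FractionRing (MvPolynomial σ k ⧸ P)))
    (hT : ∀ i, IsAlgebraic (Algebra.adjoin k (T : Set (FractionRing (MvPolynomial σ k ⧸ P))))
      (algebraMap (MvPolynomial σ k ⧸ P) (FractionRing (MvPolynomial σ k ⧸ P))
        (Ideal.Quotient.mk P (MvPolynomial.X i)))) :
    ringKrullDim (MvPolynomial σ k ⧸ P) ≤ T.card := by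
  refine ringKrullDim_le_card_of_isAlgebraic
    (IsScalarTower.toAlgHom k _ (FractionRing (MvPolynomial σ k ⧸ P)))
    (IsFractionRing.injective _ _) T fun a => ?_
  obtain ⟨p, rfl⟩ := Ideal.Quotient.mk_surjective a
  induction p using MvPolynomial.induction_on with
  | C c =>
    have h : IsScalarTower.toAlgHom k (MvPolynomial σ k ⧸ P)
        (FractionRing (MvPolynomial σ k ⧸ P)) (Ideal.Quotient.mk P (MvPolynomial.C c)) =
        algebraMap (Algebra.adjoin k (T : Set (FractionRing (MvPolynomial σ k ⧸ P)))) _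
          (algebraMap k _ c) := by
      rw [← IsScalarTower.algebraMap_apply]
      exact AlgHom.commutes _ c
    rw [h]
    exact isAlgebraic_algebraMap _
  | add p q hp hq => simpa using hp.add hq
  | mul_X p i hp => simpa using hp.mul (hT i)

/-- The dimension of a quotient is bounded by that of its irreducible components. -/
theorem ringKrullDim_quotient_add_le {R : Type*} [CommRing R] (I : Ideal R) (c n : ℕ)
    (h : ∀ P : Ideal R, P.IsPrime → I ≤ P → ringKrullDim (R ⧸ P) + c ≤ (n : WithBot ℕ∞)) :
    ringKrullDim (R ⧸ I) + c ≤ (n : WithBot ℕ∞) := by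
  -- A chain of primes over `I` lies above its first member, which serves as `P`.
  have key : ∀ l : LTSeries (PrimeSpectrum.zeroLocus (R := R) I), l.length + c ≤ n := by
    intro l
    have hP := h l.head.1.asIdeal l.head.1.isPrime l.head.2
    let l' : LTSeries (PrimeSpectrum.zeroLocus (R := R) l.head.1.asIdeal) :=
      { length := l.length
        toFun := fun i => ⟨(l i).1, l.head_le i⟩
        step := fun i => l.step i }
    have hl : (l.length : WithBot ℕ∞) ≤ ringKrullDim (R ⧸ l.head.1.asIdeal) := by
      rw [ringKrullDim_quotient]
      exact Order.LTSeries.length_le_krullDim l'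
    have := (add_le_add_left hl (c : WithBot ℕ∞)).trans hP
    exact_mod_cast this
  rw [ringKrullDim_quotient]
  rcases isEmpty_or_nonempty (PrimeSpectrum.zeroLocus (R := R) I) with he | ⟨⟨x⟩⟩
  -- Zero quotient: the dimension is `⊥` and absorbs `c`. This covers empty loci.
  · simp [Order.krullDim_eq_bot]
  · have hc : c ≤ n := by simpa using key (RelSeries.singleton _ x)
    have hle : Order.krullDim (PrimeSpectrum.zeroLocus (R := R) I) ≤ ((n - c : ℕ) : WithBot ℕ∞) :=
      iSup_le fun l => by
        have := key l
        exact_mod_cast (by omega : l.length ≤ n - c)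
    refine (add_le_add_left hle (c : WithBot ℕ∞)).trans ?_
    exact_mod_cast (by omega : n - c + c ≤ n)

theorem ringKrullDim_quotient_radical {R : Type*} [CommRing R] (I : Ideal R) :
    ringKrullDim (R ⧸ I.radical) = ringKrullDim (R ⧸ I) := by
  rw [ringKrullDim_quotient, ringKrullDim_quotient, PrimeSpectrum.zeroLocus_radical]

/-- The automorphism of the polynomial ring induced by the translation by `a`. -/
noncomputable def translation {σ k : Type*} [CommRing k] (a : σ → k) :
    MvPolynomial σ k ≃ₐ[k] MvPolynomial σ k :=
  AlgEquiv.ofAlgHom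
    (MvPolynomial.aeval fun i => MvPolynomial.X i + MvPolynomial.C (a i))
    (MvPolynomial.aeval fun i => MvPolynomial.X i - MvPolynomial.C (a i))
    (by ext; simp [MvPolynomial.algebraMap_eq]) (by ext; simp [MvPolynomial.algebraMap_eq])

/-- The maximal ideal of a point of affine space has the expected height. -/
theorem card_le_height_vanishingIdeal_singleton {σ k : Type*} [Finite σ] [Field k] [IsAlgClosed k]
    (x : σ → k) : (Nat.card σ : WithBot ℕ∞) ≤ (MvPolynomial.vanishingIdeal k {x}).height := by
  -- By the Nullstellensatz all maximal ideals are translates of one another, so they share the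
  -- height that computes the dimension.
  have h : ringKrullDim (MvPolynomial σ k) ≤ (MvPolynomial.vanishingIdeal k {x}).height := by
    rw [ringKrullDim_le_iff_isMaximal_height_le]
    intro m hm
    obtain ⟨y, rfl⟩ := MvPolynomial.isMaximal_iff_eq_vanishingIdeal_singleton.mp hm
    have e : MvPolynomial.vanishingIdeal k {y} =
        (MvPolynomial.vanishingIdeal k {x}).comap (translation (y - x)).toRingEquiv := by
      ext p
      have : (MvPolynomial.aeval y : MvPolynomial σ k →ₐ[k] k) =
          (MvPolynomial.aeval x).comp (translation (y - x)).toAlgHom := by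
        ext i
        simp [translation]
      simp only [Ideal.mem_comap, MvPolynomial.mem_vanishingIdeal_singleton_iff, this]
      rfl
    rw [e, RingEquiv.height_comap]
  rwa [MvPolynomial.ringKrullDim_of_isNoetherianRing, ringKrullDim_eq_zero_of_field,
    zero_add] at h

/-- The zero locus of `m` polynomials has codimension at most `m` if it is not empty. -/
theorem card_le_ringKrullDim_quotient_vanishingIdeal_add {σ k τ : Type*} [Finite σ] [Field k]
    [IsAlgClosed k] [Fintype τ] (p : τ → MvPolynomial σ k) (x : σ → k)
    (hx : ∀ i, MvPolynomial.aeval x (p i) = 0) :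
    (Nat.card σ : WithBot ℕ∞) ≤ ringKrullDim (MvPolynomial σ k ⧸
      MvPolynomial.vanishingIdeal k {y : σ → k | ∀ i, MvPolynomial.aeval y (p i) = 0}) +
        Fintype.card τ := by
  have hz : {y : σ → k | ∀ i, MvPolynomial.aeval y (p i) = 0} =
      MvPolynomial.zeroLocus k (Ideal.span (Set.range p)) := by
    rw [MvPolynomial.zeroLocus_span]
    ext y
    simp
  rw [hz, MvPolynomial.vanishingIdeal_zeroLocus_eq_radical, ringKrullDim_quotient_radical]
  refine (card_le_height_vanishingIdeal_singleton x).trans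
    ((Ideal.height_le_ringKrullDim_quotient_add_encard (Set.range p) ?_).trans ?_)
  · rintro _ ⟨i, rfl⟩
    exact (MvPolynomial.mem_vanishingIdeal_singleton_iff x _).mpr (hx i)
  · gcongr
    have : (Set.range p).encard ≤ Fintype.card τ := by
      rw [← Set.image_univ]
      refine (Set.encard_image_le _ _).trans ?_
      simp
    exact_mod_cast this

end KrullDimension

/-! ### Extension of scalars and the cost of one isotropic vector -/

section LinearAlgebra

variable {F K κ : Type*} [Field F] [Field K] [Algebra F K]

/-- If the entries of `y` satisfy the linear relations in `U`, then they lie in the `F`-span of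
`#κ - dim U` elements. -/
theorem exists_finset_span_of_relations [Fintype κ] (U : Submodule F (κ → F)) (y : κ → K)
    (h : ∀ u ∈ U, ∑ j, u j • y j = 0) :
    ∃ T : Finset K, T.card + Module.finrank F U ≤ Fintype.card κ ∧
      ∀ j, y j ∈ Submodule.span F (T : Set K) := by
  classical
  set φ : (κ → F) →ₗ[F] K := Fintype.linearCombination F y with hφ
  have hU : U ≤ LinearMap.ker φ := fun u hu => by
    simpa [hφ, Fintype.linearCombination_apply] using h u hu
  have hrank := φ.finrank_range_add_finrank_ker
  have hle := Submodule.finrank_mono hU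
  rw [Module.finrank_fintype_fun_eq_card] at hrank
  let b := Module.finBasis F (LinearMap.range φ)
  refine ⟨Finset.univ.image fun i => (b i : K), ?_, fun j => ?_⟩
  · have : (Finset.univ.image fun i => (b i : K)).card ≤ _ := Finset.card_image_le
    rw [Finset.card_univ, Fintype.card_fin] at this
    omega
  · have hj : y j ∈ LinearMap.range φ :=
      ⟨Pi.single j 1, by simp [hφ, Fintype.linearCombination_apply_single]⟩
    have hr := congrArg (fun v : LinearMap.range φ => (v : K)) (b.sum_repr ⟨y j, hj⟩)
    simp only [Submodule.coe_sum, Submodule.coe_smul] at hr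
    rw [← hr]
    exact Submodule.sum_mem _ fun i _ => Submodule.smul_mem _ _ (Submodule.subset_span (by simp))

variable (F K κ) in
/-- The inclusion of `F ^ κ` into `K ^ κ`. -/
def vecMap : (κ → F) →ₗ[F] (κ → K) := (Algebra.linearMap F K).compLeft κ

@[simp] theorem vecMap_apply (v : κ → F) (j : κ) : vecMap F K κ v j = algebraMap F K (v j) := rfl

/-- Extension of scalars of a subspace of `F ^ κ`. -/
def extend (K : Type*) [Field K] [Algebra F K] (S : Submodule F (κ → F)) : Submodule K (κ → K) :=
  Submodule.span K (vecMap F K κ '' S)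

theorem extend_span (s : Set (κ → F)) :
    extend K (Submodule.span F s) = Submodule.span K (vecMap F K κ '' s) := by
  rw [extend, ← Submodule.map_coe, Submodule.map_span]
  exact Submodule.span_span_of_tower F K _

theorem finrank_extend_le [Fintype κ] (S : Submodule F (κ → F)) :
    Module.finrank K (extend K S) ≤ Module.finrank F S := by
  classical
  let b := Module.finBasis F S
  have hS : S = Submodule.span F (Set.range fun i => (b i : κ → F)) := by
    have := congrArg (Submodule.map S.subtype) b.span_eq
    rw [Submodule.map_span, Submodule.map_top, Submodule.range_subtype, ← Set.range_comp] at this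
    exact this.symm
  conv_lhs => rw [hS]
  rw [extend_span, ← Set.range_comp]
  refine (finrank_range_le_card _).trans ?_
  simp

/-- The solutions over `K` of linear equations over `F` are spanned by solutions over `F`. -/
theorem mem_extend_of_forall_sum_eq_zero [Fintype κ] (W : Submodule F (κ → F)) (A : Set (κ → F))
    (hW : ∀ w, (∀ a ∈ A, ∑ j, a j * w j = 0) → w ∈ W) (y : κ → K)
    (hy : ∀ a ∈ A, ∑ j, a j • y j = 0) : y ∈ extend K W := by
  classical
  -- In an `F`-basis of `K`, each coordinate of a solution is a solution over `F`.
  let e := Module.Basis.ofVectorSpace F K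
  let w : Module.Basis.ofVectorSpaceIndex F K → κ → F := fun b j => e.repr (y j) b
  have hw : ∀ b, w b ∈ W := fun b => hW _ fun a ha => by
    have := congrArg (fun x => e.repr x b) (hy a ha)
    simpa [w, Finsupp.finsetSum_apply] using this
  let B : Finset (Module.Basis.ofVectorSpaceIndex F K) :=
    Finset.univ.biUnion fun j => (e.repr (y j)).support
  have hsum : y = ∑ b ∈ B, e b • vecMap F K κ (w b) := by
    ext j
    have h1 : ∑ b ∈ (e.repr (y j)).support, e.repr (y j) b • e b = y j := by
      simpa [Finsupp.linearCombination_apply, Finsupp.sum] using e.linearCombination_repr (y j)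
    have h2 : ∑ b ∈ B, e.repr (y j) b • e b = y j := by
      refine Eq.trans (Eq.symm ?_) h1
      refine Finset.sum_subset
        (fun b hb => Finset.mem_biUnion.mpr ⟨j, Finset.mem_univ _, hb⟩) ?_
      intro b _ hb
      simp [Finsupp.notMem_support_iff.mp hb]
    rw [← h2]
    simp [w, Finset.sum_apply, Algebra.smul_def, mul_comm]
  rw [hsum]
  exact Submodule.sum_mem _ fun b _ => Submodule.smul_mem _ _
    (Submodule.subset_span ⟨_, hw b, rfl⟩)

variable [Fintype κ]

theorem sum_vecMul_smul (Q : Matrix κ κ F) (u : κ → F) (y : κ → K) :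
    ∑ j, (u ᵥ* Q) j • y j = vecMap F K κ u ⬝ᵥ Q.map (algebraMap F K) *ᵥ y := by
  rw [dotProduct_mulVec]
  simp only [dotProduct, Algebra.smul_def]
  refine Finset.sum_congr rfl fun j _ => ?_
  congr 1
  simp [vecMul, dotProduct]

/-- The orthogonal space of `S` contains an anisotropic vector unless its scalar extension is
contained in that of `S`. -/
theorem exists_orthogonal_anisotropic [DecidableEq κ] [NeZero (2 : F)] (Q : Matrix κ κ F) (hQ : Q.IsSymm)
    (hQ' : Q.det ≠ 0) (S : Submodule F (κ → F)) (y : κ → K)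
    (hy : ∀ u ∈ S, vecMap F K κ u ⬝ᵥ Q.map (algebraMap F K) *ᵥ y = 0) (hyS : y ∉ extend K S) :
    ∃ w : κ → F, (∀ u ∈ S, u ⬝ᵥ Q *ᵥ w = 0) ∧ w ⬝ᵥ Q *ᵥ w ≠ 0 := by
  by_contra! hcon
  apply hyS
  set B := Matrix.toBilin' Q with hB
  have hBsymm : ∀ u v, B u v = B v u := fun u v => by
    rw [hB, Matrix.toBilin'_apply', Matrix.toBilin'_apply', dotProduct_mulVec, dotProduct_comm,
      ← mulVec_transpose, hQ.eq]
  have hnd : B.Nondegenerate := LinearMap.BilinForm.nondegenerate_toBilin'_iff_det_ne_zero.mpr hQ'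
  have hrefl : B.IsRefl := fun u v h => (hBsymm v u).trans h
  have hself : ∀ w ∈ B.orthogonal S, B w w = 0 := fun w hw => by
    rw [hB, Matrix.toBilin'_apply']
    exact hcon w fun u hu => by rw [← Matrix.toBilin'_apply']; exact hw u hu
  -- If the quadratic form vanishes on `S`^⊥, polarisation (2 ≠ 0) makes `S`^⊥ totally isotropic,
  -- hence contained in `S`^⊥⊥ = `S`.
  have hWS : B.orthogonal S ≤ S := by
    conv_rhs => rw [← LinearMap.BilinForm.orthogonal_orthogonal hnd hrefl S]
    intro w hw v hv
    have h1 := hself _ (Submodule.add_mem _ hv hw)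
    simp only [map_add, LinearMap.add_apply, hself w hw, hself v hv, hBsymm w v] at h1
    have h2 : (2 : F) * B v w = 0 := by linear_combination h1
    exact (mul_eq_zero.mp h2).resolve_left (NeZero.ne _)
  have hmem := mem_extend_of_forall_sum_eq_zero (K := K) (B.orthogonal S)
    ((fun u => u ᵥ* Q) '' S) (fun w hw u hu => by
      have := hw _ ⟨u, hu, rfl⟩
      change B u w = 0
      rw [hB, Matrix.toBilin'_apply', dotProduct_mulVec]
      exact this) y (by
      rintro _ ⟨u, hu, rfl⟩
      rw [sum_vecMul_smul]
      exact hy u hu)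
  exact Submodule.span_mono (Set.image_mono hWS) hmem

/-- An isotropic vector over `K` that is orthogonal to a subspace `S` of `F ^ κ` but not
contained in its extension depends algebraically on at most `#κ - dim S - 1` parameters. -/
theorem exists_parameters_of_notMem_extend [DecidableEq κ] [NeZero (2 : F)] (Q : Matrix κ κ F)
    (hQ : Q.IsSymm) (hQ' : Q.det ≠ 0) (S : Submodule F (κ → F)) (y : κ → K)
    (hy : ∀ u ∈ S, vecMap F K κ u ⬝ᵥ Q.map (algebraMap F K) *ᵥ y = 0)
    (hyy : y ⬝ᵥ Q.map (algebraMap F K) *ᵥ y = 0) (hyS : y ∉ extend K S) :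
    ∃ T : Finset K, T.card + Module.finrank K (extend K S) + 1 ≤ Fintype.card κ ∧
      ∀ j, IsAlgebraic (Algebra.adjoin F (T : Set K)) (y j) := by
  obtain ⟨w, hwS, hww⟩ := exists_orthogonal_anisotropic Q hQ hQ' S y hy hyS
  set QK := Q.map (algebraMap F K) with hQK
  set w' := vecMap F K κ w with hw'
  set c := w ⬝ᵥ Q *ᵥ w with hc
  have hbase : ∀ u v : κ → F, vecMap F K κ u ⬝ᵥ QK *ᵥ vecMap F K κ v =
      algebraMap F K (u ⬝ᵥ Q *ᵥ v) := fun u v => by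
    simp [dotProduct, mulVec, hQK]
  have hsymm : ∀ u v : κ → K, u ⬝ᵥ QK *ᵥ v = v ⬝ᵥ QK *ᵥ u := fun u v => by
    have : QKᵀ = QK := by rw [hQK, ← Matrix.transpose_map, hQ.eq]
    rw [dotProduct_mulVec, dotProduct_comm, ← mulVec_transpose, this]
  have hcK : algebraMap F K c ≠ 0 := by simpa using hww
  -- Split off the component of `y` along `w`; the rest `y'` is orthogonal to `S` and to `w`, which
  -- gives dim `S` + 1 linear relations over `F`.
  set t := (w' ⬝ᵥ QK *ᵥ y) / algebraMap F K c with ht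
  set y' := y - t • w' with hy'
  have hwy' : w' ⬝ᵥ QK *ᵥ y' = 0 := by
    rw [hy', mulVec_sub, mulVec_smul, dotProduct_sub, dotProduct_smul, hbase, ht, smul_eq_mul,
      div_mul_cancel₀ _ hcK, sub_self]
  have hSy' : ∀ u ∈ S, vecMap F K κ u ⬝ᵥ QK *ᵥ y' = 0 := fun u hu => by
    rw [hy', mulVec_sub, mulVec_smul, dotProduct_sub, dotProduct_smul, hbase, hy u hu, hwS u hu]
    simp
  have hwnot : w ∉ S := fun h => hww (hwS w h)
  have hinj : Function.Injective Q.vecMulLinear :=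
    vecMul_injective_of_isUnit ((Matrix.isUnit_iff_isUnit_det Q).mpr hQ'.isUnit)
  obtain ⟨T, hTcard, hT⟩ := exists_finset_span_of_relations
    ((S ⊔ Submodule.span F {w}).map Q.vecMulLinear) y' (by
      rintro _ ⟨v, hv, rfl⟩
      obtain ⟨u, hu, z, hz, rfl⟩ := Submodule.mem_sup.mp hv
      obtain ⟨r, rfl⟩ := Submodule.mem_span_singleton.mp hz
      rw [Matrix.vecMulLinear_apply, sum_vecMul_smul, map_add, map_smul, add_dotProduct,
        hSy' u hu, smul_dotProduct, hwy', smul_zero, add_zero])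
  have hfin : Module.finrank F ((S ⊔ Submodule.span F {w}).map Q.vecMulLinear) =
      Module.finrank F S + 1 := by
    rw [← (Submodule.equivMapOfInjective _ hinj _).finrank_eq]
    exact Submodule.finrank_sup_span_singleton hwnot
  have hle := finrank_extend_le (K := K) S
  refine ⟨T, by omega, fun j => ?_⟩
  have hspan : ∀ j, y' j ∈ Algebra.adjoin F (T : Set K) := fun j =>
    Algebra.span_le_adjoin F _ (hT j)
  have halg : ∀ a ∈ Algebra.adjoin F (T : Set K),
      IsAlgebraic (Algebra.adjoin F (T : Set K)) a := fun a ha =>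
    isAlgebraic_algebraMap (⟨a, ha⟩ : Algebra.adjoin F (T : Set K))
  have hF : ∀ a : F, algebraMap F K a ∈ Algebra.adjoin F (T : Set K) := fun a =>
    Subalgebra.algebraMap_mem _ a
  have hyeq : y = y' + t • w' := by rw [hy', sub_add_cancel]
  -- Isotropy of `y` expresses `t ^ 2` through `y'`, so `t` costs no parameter.
  have hsq : t ^ 2 = algebraMap F K (-c⁻¹) * (y' ⬝ᵥ QK *ᵥ y') := by
    have h := hyy
    rw [hyeq, mulVec_add, mulVec_smul, add_dotProduct, dotProduct_add, dotProduct_add,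
      smul_dotProduct, smul_dotProduct, dotProduct_smul, dotProduct_smul, hsymm y' w', hwy', hbase,
      ← hc] at h
    simp only [smul_eq_mul, mul_zero, add_zero, zero_add] at h
    rw [map_neg, map_inv₀]
    field_simp
    linear_combination h
  have ht2 : t ^ 2 ∈ Algebra.adjoin F (T : Set K) := by
    rw [hsq]
    refine mul_mem (hF _) (sum_mem fun i _ => mul_mem (hspan i) (sum_mem fun l _ => ?_))
    exact mul_mem (hF _) (hspan l)
  have htalg : IsAlgebraic (Algebra.adjoin F (T : Set K)) t :=
    (halg _ ht2).of_pow two_pos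
  have : y j = y' j + t * algebraMap F K (w j) := by
    conv_lhs => rw [hyeq]
    rfl
  rw [this]
  exact (halg _ (hspan j)).add (htalg.mul (halg _ (hF _)))

/-- A vector in the extension of `S` depends on at most `dim S` parameters. -/
theorem exists_parameters_of_mem_extend (S : Submodule F (κ → F)) (y : κ → K)
    (hyS : y ∈ extend K S) :
    ∃ T : Finset K, T.card ≤ Module.finrank K (extend K S) ∧
      ∀ j, IsAlgebraic (Algebra.adjoin F (T : Set K)) (y j) := by
  classical
  -- A basis of the extension chosen among vectors of `S` has entries in `F`, so the coefficients of
  -- `y` suffice as parameters.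
  obtain ⟨b, hb, hspan, hli⟩ := exists_linearIndependent K (vecMap F K κ '' (S : Set (κ → F)))
  have : Fintype b := (hli.setFinite).fintype
  have hcard : Fintype.card b = Module.finrank K (extend K S) := by
    rw [extend, ← hspan, ← Set.toFinset_card]
    exact (finrank_span_set_eq_card hli).symm
  have hyb : y ∈ Submodule.span K (Set.range ((↑) : b → κ → K)) := by
    rw [Subtype.range_coe, hspan]
    exact hyS
  obtain ⟨c, hc⟩ := (Submodule.mem_span_range_iff_exists_fun K).mp hyb
  refine ⟨Finset.univ.image c, Finset.card_image_le.trans (by simp [hcard]), fun j => ?_⟩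
  have hmem : y j ∈ Algebra.adjoin F ((Finset.univ.image c : Finset K) : Set K) := by
    rw [← hc, Finset.sum_apply]
    refine sum_mem fun i _ => mul_mem (Algebra.subset_adjoin (by simp)) ?_
    obtain ⟨v, -, hv⟩ := hb i.2
    rw [← hv]
    exact Subalgebra.algebraMap_mem _ _
  exact isAlgebraic_algebraMap
    (⟨y j, hmem⟩ : Algebra.adjoin F ((Finset.univ.image c : Finset K) : Set K))

end LinearAlgebra

/-! ### Counting parameters row by row -/

section Parameters

variable {k K : Type*} [Field k] [Field K] [Algebra k K]

/-- The field of elements of `K` that are algebraic over `k[T]`. -/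
def relClosure (k : Type*) {K : Type*} [Field k] [Field K] [Algebra k K] (T : Set K) :
    IntermediateField k K where
  carrier := {x | IsAlgebraic (Algebra.adjoin k T) x}
  mul_mem' h₁ h₂ := h₁.mul h₂
  add_mem' h₁ h₂ := h₁.add h₂
  algebraMap_mem' c := isAlgebraic_algebraMap (algebraMap k (Algebra.adjoin k T) c)
  inv_mem' _ h := h.inv

theorem mem_relClosure {T : Set K} {x : K} :
    x ∈ relClosure k T ↔ IsAlgebraic (Algebra.adjoin k T) x := Iff.rfl

/-- Transitivity of algebraicity: it lets the parameters of a new row, found over the relative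
closure, be added to the old ones. -/
theorem isAlgebraic_adjoin_union {T T' : Set K} {a : K}
    (h : IsAlgebraic (Algebra.adjoin (relClosure k T) T') a) :
    IsAlgebraic (Algebra.adjoin k (T ∪ T')) a := by
  have h1 : IsAlgebraic (Algebra.adjoin k ((relClosure k T : Set K) ∪ T')) a := by
    have h2 : IsAlgebraic ((Algebra.adjoin (relClosure k T).toSubalgebra T').restrictScalars k) a :=
      h
    rwa [Algebra.restrictScalars_adjoin] at h2
  refine h1.adjoin_of_forall_isAlgebraic ?_
  rintro x ⟨hx | hx, hx'⟩
  · exact (mem_relClosure.mp hx).adjoin_of_forall_isAlgebraic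
      fun z hz => (hz.2 (Or.inl hz.1)).elim
  · exact (hx' (Or.inr hx)).elim

/-- The entries of pairwise orthogonal isotropic vectors spanning a space of dimension `r` are
algebraic over `r (#κ + #s - r) - r (r + 1) / 2` parameters. -/
theorem exists_parameters_of_isotropic {ι κ : Type*} [Fintype κ] [DecidableEq κ] [NeZero (2 : k)]
    (Q : Matrix κ κ k) (hQ : Q.IsSymm) (hQ' : Q.det ≠ 0) (Y : ι → κ → K)
    (hY : ∀ i j, Y i ⬝ᵥ Q.map (algebraMap k K) *ᵥ Y j = 0) (s : Finset ι) :
    ∃ T : Finset K,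
      2 * T.card + 3 * Module.finrank K (Submodule.span K (Y '' s)) ^ 2 +
          Module.finrank K (Submodule.span K (Y '' s)) ≤
        2 * Module.finrank K (Submodule.span K (Y '' s)) * (Fintype.card κ + s.card) ∧
      ∀ i ∈ s, ∀ j, IsAlgebraic (Algebra.adjoin k (T : Set K)) (Y i j) := by
  classical
  induction s using Finset.induction_on with
  | empty =>
    rw [Finset.coe_empty, Set.image_empty, Submodule.span_empty]
    exact ⟨∅, by simp, by simp⟩
  | insert a s ha ih =>
    obtain ⟨T, hcard, hT⟩ := ih
    have : NeZero (2 : relClosure k (T : Set K)) := ⟨fun h => NeZero.ne (2 : k) <|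
      (algebraMap k (relClosure k (T : Set K))).injective (by rw [map_ofNat, map_zero]; exact h)⟩
    set F := relClosure k (T : Set K) with hF
    set QF := Q.map (algebraMap k F) with hQF
    have hQFK : QF.map (algebraMap F K) = Q.map (algebraMap k K) := by
      ext i j
      simp [hQF, ← IsScalarTower.algebraMap_apply]
    -- The earlier rows have entries in `F`, so their span is defined over `F`.
    set S : Submodule F (κ → F) := Submodule.span F {v | vecMap F K κ v ∈ Y '' s} with hS
    have himage : vecMap F K κ '' {v | vecMap F K κ v ∈ Y '' s} = Y '' s := by
      refine Set.image_preimage_eq_of_subset ?_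
      rintro _ ⟨i, hi, rfl⟩
      exact ⟨fun j => ⟨Y i j, hT i hi j⟩, rfl⟩
    have hext : extend K S = Submodule.span K (Y '' s) := by rw [hS, extend_span, himage]
    -- The count for an independent row has slack 2(#`s` - r), which this makes nonnegative.
    have hr : Module.finrank K (extend K S) ≤ s.card := by
      rw [hext, ← Finset.coe_image]
      exact (finrank_span_finset_le_card _).trans Finset.card_image_le
    have horth : ∀ u ∈ S, vecMap F K κ u ⬝ᵥ QF.map (algebraMap F K) *ᵥ Y a = 0 := by
      intro u hu
      rw [hQFK]
      induction hu using Submodule.span_induction with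
      | mem v hv =>
        obtain ⟨i, -, hi⟩ := hv
        rw [← hi, hY]
      | zero => simp
      | add x y _ _ hx hy => rw [map_add, add_dotProduct, hx, hy, add_zero]
      | smul c x _ hx => rw [map_smul, smul_dotProduct, hx, smul_zero]
    have hmono : ∀ T' : Finset K, ∀ i ∈ s, ∀ j,
        IsAlgebraic (Algebra.adjoin k ((T ∪ T' : Finset K) : Set K)) (Y i j) := by
      intro T' i hi j
      refine (hT i hi j).adjoin_of_forall_isAlgebraic fun z hz => (hz.2 ?_).elim
      simpa using Or.inl hz.1
    have hall : ∀ T' : Finset K, (∀ j, IsAlgebraic (Algebra.adjoin F (T' : Set K)) (Y a j)) →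
        ∀ i ∈ insert a s, ∀ j,
          IsAlgebraic (Algebra.adjoin k ((T ∪ T' : Finset K) : Set K)) (Y i j) := by
      intro T' hT' i hi j
      rcases Finset.mem_insert.mp hi with rfl | hi
      · rw [Finset.coe_union]
        exact isAlgebraic_adjoin_union (hT' j)
      · exact hmono T' i hi j
    rw [Finset.card_insert_of_notMem ha, Finset.coe_insert, Set.image_insert_eq]
    rw [← hext] at hcard
    by_cases hmem : Y a ∈ extend K S
    · obtain ⟨T', hT'card, hT'⟩ := exists_parameters_of_mem_extend S (Y a) hmem
      refine ⟨T ∪ T', ?_, hall T' hT'⟩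
      have hspan : Submodule.span K (insert (Y a) (Y '' s)) = extend K S := by
        rw [Submodule.span_insert_eq_span (by rwa [← hext]), hext]
      rw [hspan]
      have := Finset.card_union_le T T'
      nlinarith
    · obtain ⟨T', hT'card, hT'⟩ := exists_parameters_of_notMem_extend QF
        (by rw [Matrix.IsSymm, hQF, ← Matrix.transpose_map, hQ.eq])
        (by rw [hQF, ← RingHom.mapMatrix_apply, ← RingHom.map_det]; simpa using hQ')
        S (Y a) horth (by rw [hQFK]; exact hY a a) hmem
      refine ⟨T ∪ T', ?_, hall T' hT'⟩
      have hspan : Module.finrank K (Submodule.span K (insert (Y a) (Y '' s))) =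
          Module.finrank K (extend K S) + 1 := by
        rw [Submodule.span_insert, sup_comm, ← hext]
        exact Submodule.finrank_sup_span_singleton hmem
      rw [hspan]
      have := Finset.card_union_le T T'
      nlinarith

/-- A matrix of full row rank has a nonzero maximal minor. -/
theorem exists_det_submatrix_ne_zero {ι κ : Type*} [Fintype ι] [DecidableEq ι] [Fintype κ]
    (A : Matrix ι κ K) (h : LinearIndependent K A.row) :
    ∃ f : ι → κ, (A.submatrix id f).det ≠ 0 := by
  have hrank := h.rank_matrix
  rw [Matrix.rank_eq_finrank_span_cols] at hrank
  have htop : Submodule.span K (Set.range A.col) = ⊤ :=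
    Submodule.eq_top_of_finrank_eq (by rw [hrank, Module.finrank_fintype_fun_eq_card])
  obtain ⟨τ, a, -, hspan, hli⟩ := exists_linearIndependent' K A.col
  let b := Module.Basis.mk hli (by rw [hspan, htop])
  let e : ι ≃ τ := (Pi.basisFun K ι).indexEquiv b
  refine ⟨a ∘ e, ?_⟩
  have hcol : LinearIndependent K (A.submatrix id (a ∘ e)).col := hli.comp e e.injective
  rw [Matrix.linearIndependent_cols_iff_isUnit, Matrix.isUnit_iff_isUnit_det] at hcol
  exact hcol.ne_zero

end Parameters

/-! ### The zero fibre and its degenerate locus -/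

section Moment

variable {ι κ : Type*} [Fintype κ]

/-- The entries of the moment map as polynomials. -/
noncomputable def momentPoly (Q : Matrix κ κ ℂ) (i j : ι) : MvPolynomial (ι × κ) ℂ :=
  (fun a => MvPolynomial.X (i, a)) ⬝ᵥ Q.map MvPolynomial.C *ᵥ (fun a => MvPolynomial.X (j, a))

theorem map_momentPoly {A : Type*} [CommRing A] [Algebra ℂ A] (f : MvPolynomial (ι × κ) ℂ →ₐ[ℂ] A)
    (Q : Matrix κ κ ℂ) (i j : ι) :
    f (momentPoly Q i j) = (fun a => f (MvPolynomial.X (i, a))) ⬝ᵥ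
      Q.map (algebraMap ℂ A) *ᵥ (fun a => f (MvPolynomial.X (j, a))) := by
  have hC : ∀ c : ℂ, f (MvPolynomial.C c) = algebraMap ℂ A c := f.commutes
  simp [momentPoly, dotProduct, mulVec, hC]

theorem momentPoly_comm {Q : Matrix κ κ ℂ} (hQ : Q.IsSymm) (i j : ι) :
    momentPoly Q i j = momentPoly Q j i := by
  rw [momentPoly, dotProduct_mulVec, dotProduct_comm, ← mulVec_transpose,
    ← Matrix.transpose_map, hQ.eq, momentPoly]

theorem momentMap_apply (Q : Matrix κ κ ℂ) (X : Matrix ι κ ℂ) (i j : ι) :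
    momentMap Q X i j = X i ⬝ᵥ Q *ᵥ X j := by
  rw [momentMap, dotProduct_mulVec]
  rfl

theorem aeval_momentPoly (Q : Matrix κ κ ℂ) (x : ι × κ → ℂ) (i j : ι) :
    MvPolynomial.aeval x (momentPoly Q i j) = momentMap Q (Matrix.of fun i a => x (i, a)) i j := by
  rw [map_momentPoly, momentMap_apply]
  simp [dotProduct, mulVec]

theorem momentPoly_mem_vanishingIdeal (Q : Matrix κ κ ℂ) (i j : ι) {S : Set (Matrix ι κ ℂ)}
    (hS : S ⊆ zeroFibre Q) : momentPoly Q i j ∈ MvPolynomial.vanishingIdeal ℂ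
      ((fun (X : Matrix ι κ ℂ) (p : ι × κ) => X p.1 p.2) '' S) := by
  rintro _ ⟨X, hX, rfl⟩
  rw [aeval_momentPoly]
  exact congrFun (congrFun (hS hX) i) j

/-- An infinite stabiliser contains some g ≠ 1, and a nonzero row of g - 1 is annihilated by `Xᵗ`.
-/
theorem infiniteIsotropyLocus_subset [Fintype ι] (J : Matrix ι ι ℂ)
    (Q : Matrix κ κ ℂ) : infiniteIsotropyLocus J Q ⊆ degenerateLocus Q := by
  classical
  rintro X ⟨hX, hinf⟩
  refine ⟨hX, ?_⟩
  obtain ⟨g, ⟨-, hg⟩, hg1⟩ := hinf.exists_notMem_finite (Set.finite_singleton 1)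
  obtain ⟨i, hi⟩ : ∃ i, (g - 1) i ≠ 0 := by
    by_contra! h
    exact hg1 (sub_eq_zero.mp (funext h))
  refine ⟨(g - 1) i, hi, ?_⟩
  have h0 : (g - 1) * X = 0 := by rw [Matrix.sub_mul, hg, Matrix.one_mul, sub_self]
  rw [mulVec_transpose]
  exact congrFun h0 i

variable [Fintype ι]

/-- Symmetry of `Q` allows the equations to be indexed by `Sym2 ι`, and the origin is a common zero.
-/
theorem card_le_zariskiDim_zeroFibre_add {Q : Matrix κ κ ℂ} (hQ : Q.IsSymm) :
    ((Fintype.card ι * Fintype.card κ : ℕ) : WithBot ℕ∞) ≤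
      zariskiDim (zeroFibre Q : Set (Matrix ι κ ℂ)) + ((Fintype.card ι + 1).choose 2 : ℕ) := by
  let p : Sym2 ι → MvPolynomial (ι × κ) ℂ := Sym2.lift ⟨momentPoly Q, momentPoly_comm hQ⟩
  have hp : ∀ x : ι × κ → ℂ, (∀ q, MvPolynomial.aeval x (p q) = 0) ↔
      momentMap Q (Matrix.of fun (i : ι) a => x (i, a)) = 0 := by
    intro x
    rw [Sym2.forall, ← Matrix.ext_iff]
    simp only [p, Sym2.lift_mk, aeval_momentPoly]
    rfl
  have himage : (fun (X : Matrix ι κ ℂ) (p : ι × κ) => X p.1 p.2) '' zeroFibre Q =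
      {x | ∀ q, MvPolynomial.aeval x (p q) = 0} := by
    ext x
    rw [Set.mem_ofPred_eq, hp]
    constructor
    · rintro ⟨X, hX, rfl⟩
      exact hX
    · intro hx
      exact ⟨Matrix.of fun i a => x (i, a), hx, rfl⟩
  have h := card_le_ringKrullDim_quotient_vanishingIdeal_add p 0
    ((hp 0).mpr (by ext i j; simp [momentMap_apply, dotProduct]))
  rw [Sym2.card, ← himage, Nat.card_prod, Nat.card_eq_fintype_card, Nat.card_eq_fintype_card] at h
  exact h

/-- An irreducible component of the closure of a subset of the zero fibre is bounded in terms of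
the rank `r` of its generic matrix, and `r` is not maximal if all matrices are degenerate. -/
theorem exists_rank_ringKrullDim_le [DecidableEq κ] {Q : Matrix κ κ ℂ} (hQ : Q.IsSymm)
    (hQ' : Q.det ≠ 0) {S : Set (Matrix ι κ ℂ)} (hS : S ⊆ zeroFibre Q)
    (P : Ideal (MvPolynomial (ι × κ) ℂ)) [P.IsPrime]
    (hP : MvPolynomial.vanishingIdeal ℂ
      ((fun (X : Matrix ι κ ℂ) (p : ι × κ) => X p.1 p.2) '' S) ≤ P) :
    ∃ n r : ℕ, ringKrullDim (MvPolynomial (ι × κ) ℂ ⧸ P) ≤ n ∧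
      2 * n + 3 * r ^ 2 + r ≤ 2 * r * (Fintype.card κ + Fintype.card ι) ∧ r ≤ Fintype.card ι ∧
      (S ⊆ degenerateLocus Q → r < Fintype.card ι) := by
  classical
  let K := FractionRing (MvPolynomial (ι × κ) ℂ ⧸ P)
  let f : MvPolynomial (ι × κ) ℂ →ₐ[ℂ] K :=
    (IsScalarTower.toAlgHom ℂ (MvPolynomial (ι × κ) ℂ ⧸ P) K).comp (Ideal.Quotient.mkₐ ℂ P)
  have hf : ∀ p ∈ P, f p = 0 := fun p hp => by
    change algebraMap _ K (Ideal.Quotient.mk P p) = 0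
    rw [Ideal.Quotient.eq_zero_iff_mem.mpr hp, map_zero]
  -- The rows of the generic matrix.
  let Y : ι → κ → K := fun i a => f (MvPolynomial.X (i, a))
  have hY : ∀ i j, Y i ⬝ᵥ Q.map (algebraMap ℂ K) *ᵥ Y j = 0 := fun i j => by
    rw [← map_momentPoly f Q i j]
    exact hf _ (hP (momentPoly_mem_vanishingIdeal Q i j hS))
  obtain ⟨T, hcard, hT⟩ := exists_parameters_of_isotropic Q hQ hQ' Y hY Finset.univ
  rw [Finset.coe_univ, Set.image_univ, Finset.card_univ] at hcard
  have hle : Module.finrank K (Submodule.span K (Set.range Y)) ≤ Fintype.card ι :=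
    finrank_range_le_card Y
  refine ⟨T.card, _, ringKrullDim_quotient_le_card P T fun p => hT p.1 (Finset.mem_univ _) p.2,
    hcard, hle, fun hdeg => lt_of_le_of_ne hle fun heq => ?_⟩
  have hli : LinearIndependent K (Matrix.of Y).row :=
    linearIndependent_iff_card_eq_finrank_span.mpr heq.symm
  -- At full rank some maximal minor is nonzero at the generic point; yet it vanishes on degenerate
  -- matrices, so it lies in `P`.
  obtain ⟨c, hc⟩ := exists_det_submatrix_ne_zero (Matrix.of Y) hli
  let M : Matrix ι ι (MvPolynomial (ι × κ) ℂ) := Matrix.of fun i a => MvPolynomial.X (i, c a)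
  have hM : M.det ∈ P := by
    refine hP ?_
    rintro _ ⟨X, hX, rfl⟩
    obtain ⟨-, u, hu, hXu⟩ := hdeg hX
    rw [AlgHom.map_det, ← Matrix.exists_vecMul_eq_zero_iff]
    refine ⟨u, hu, funext fun a => ?_⟩
    have h0 := congrFun hXu (c a)
    rw [mulVec_transpose] at h0
    simpa [vecMul, dotProduct, M] using h0
  exact hc ((AlgHom.map_det f M).symm.trans (hf _ hM))

/-- The numerical bound on the dimension of the stratum of rank `r`. -/
theorem stratum_bound {d k n r c : ℕ} (hk : 2 * d ≤ k) (hr : r ≤ d)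
    (hn : 2 * n + 3 * r ^ 2 + r ≤ 2 * r * (k + d)) (hc : c ≤ (d - r) * (k - 2 * d + 1)) :
    n + c ≤ k * d - (d + 1).choose 2 := by
  obtain ⟨e, rfl⟩ := Nat.exists_eq_add_of_le hr
  obtain ⟨m, rfl⟩ := Nat.exists_eq_add_of_le hk
  have hch : 2 * (r + e + 1).choose 2 = (r + e) * (r + e + 1) := by
    rw [Nat.choose_two_right, Nat.mul_div_cancel' (Nat.even_mul_pred_self _).two_dvd]
    simp [mul_comm]
  rw [Nat.add_sub_cancel_left, Nat.add_sub_cancel_left] at hc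
  -- The slack e(3e + 2m - 1)/2 exceeds e(m + 1) by 3(e² - e)/2.
  have he : e ≤ e * e := Nat.le_mul_self e
  refine Nat.le_sub_of_add_le ?_
  nlinarith

/-- The case `c = 0` serves the whole fibre; on degenerate loci r < d supplies the codimension k -
2d + 1. -/
theorem zariskiDim_add_le [DecidableEq κ] {Q : Matrix κ κ ℂ} (hQ : Q.IsSymm)
    (hQ' : Q.det ≠ 0) {S : Set (Matrix ι κ ℂ)} (hS : S ⊆ zeroFibre Q) {c : ℕ}
    (hk : 2 * Fintype.card ι ≤ Fintype.card κ)
    (hc : c = 0 ∨ S ⊆ degenerateLocus Q ∧ c ≤ Fintype.card κ - 2 * Fintype.card ι + 1) :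
    zariskiDim S + c ≤
      ((Fintype.card κ * Fintype.card ι - (Fintype.card ι + 1).choose 2 : ℕ) : WithBot ℕ∞) := by
  refine ringKrullDim_quotient_add_le _ c _ fun P hprime hP => ?_
  obtain ⟨n, r, hdim, hn, hr, hdeg⟩ := exists_rank_ringKrullDim_le hQ hQ' hS P hP
  have hbound := stratum_bound (c := c) hk hr hn <| by
    rcases hc with rfl | ⟨hL, hc⟩
    · exact Nat.zero_le _
    · exact hc.trans (Nat.le_mul_of_pos_left _ (Nat.sub_pos_of_lt (hdeg hL)))
  refine (add_le_add_left hdim (c : WithBot ℕ∞)).trans ?_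
  exact_mod_cast hbound

end Moment

end SpMoment

/-! ### Assembly of the three statements -/

theorem mainTheorem4 (d k : ℕ) (hk : 2 * d ≤ k) (Q : Matrix (Fin k) (Fin k) ℂ)
    (hQ : Q.IsSymm) (hQ' : IsUnit Q.det) :
    -- the dimension of the zero fibre
    SpMoment.zariskiDim (SpMoment.zeroFibre Q : Set (Matrix (Fin d) (Fin k) ℂ)) =
        ((k * d - (d + 1).choose 2 : ℕ) : WithBot ℕ∞) ∧
    -- the locus of infinite isotropy, for every symplectic structure `J` on `ℂ^d`
    (∀ J : Matrix (Fin d) (Fin d) ℂ, Jᵀ = -J → IsUnit J.det →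
      SpMoment.zariskiDim (SpMoment.infiniteIsotropyLocus J Q) + 1 ≤
          ((k * d - (d + 1).choose 2 : ℕ) : WithBot ℕ∞) ∧
      (2 * d + 1 ≤ k →
        SpMoment.zariskiDim (SpMoment.infiniteIsotropyLocus J Q) + 2 ≤
          ((k * d - (d + 1).choose 2 : ℕ) : WithBot ℕ∞))) ∧
    -- the same bounds for the locus of non-injective maps, which makes sense for odd `d` as well
    (SpMoment.zariskiDim (SpMoment.degenerateLocus Q : Set (Matrix (Fin d) (Fin k) ℂ)) + 1 ≤
        ((k * d - (d + 1).choose 2 : ℕ) : WithBot ℕ∞) ∧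
      (2 * d + 1 ≤ k →
        SpMoment.zariskiDim (SpMoment.degenerateLocus Q : Set (Matrix (Fin d) (Fin k) ℂ)) + 2 ≤
          ((k * d - (d + 1).choose 2 : ℕ) : WithBot ℕ∞))) := by
  have hdet : Q.det ≠ 0 := hQ'.ne_zero
  have hcard : 2 * Fintype.card (Fin d) ≤ Fintype.card (Fin k) := by simpa using hk
  have hL : ∀ c : ℕ, c ≤ k - 2 * d + 1 → ∀ S : Set (Matrix (Fin d) (Fin k) ℂ),
      S ⊆ SpMoment.degenerateLocus Q →
      SpMoment.zariskiDim S + c ≤ ((k * d - (d + 1).choose 2 : ℕ) : WithBot ℕ∞) := by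
    intro c hc S hS
    have h := SpMoment.zariskiDim_add_le hQ hdet (fun X hX => (hS hX).1) hcard
      (Or.inr ⟨hS, by simpa using hc⟩)
    simpa only [Fintype.card_fin] using h
  have hbounds : ∀ S : Set (Matrix (Fin d) (Fin k) ℂ), S ⊆ SpMoment.degenerateLocus Q →
      SpMoment.zariskiDim S + 1 ≤ ((k * d - (d + 1).choose 2 : ℕ) : WithBot ℕ∞) ∧
      (2 * d + 1 ≤ k →
        SpMoment.zariskiDim S + 2 ≤ ((k * d - (d + 1).choose 2 : ℕ) : WithBot ℕ∞)) := fun S hS =>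
    ⟨by exact_mod_cast hL 1 (by omega) S hS, fun h => by exact_mod_cast hL 2 (by omega) S hS⟩
  refine ⟨le_antisymm ?_ ?_, fun J _ _ =>
    hbounds _ (SpMoment.infiniteIsotropyLocus_subset J Q), hbounds _ subset_rfl⟩
  · have h := SpMoment.zariskiDim_add_le (c := 0) hQ hdet (ι := Fin d) subset_rfl hcard (Or.inl rfl)
    simpa only [Fintype.card_fin, Nat.cast_zero, add_zero] using h
  · have h := SpMoment.card_le_zariskiDim_zeroFibre_add (ι := Fin d) hQ
    simp only [Fintype.card_fin] at h
    generalize SpMoment.zariskiDim (SpMoment.zeroFibre Q : Set (Matrix (Fin d) (Fin k) ℂ)) = D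
      at h ⊢
    -- The lower bound rules out `⊥`; the binomial can then be subtracted in `ℕ∞`.
    induction D using WithBot.recBotCoe with
    | bot =>
      rw [WithBot.bot_add, le_bot_iff] at h
      exact absurd h (WithBot.natCast_ne_bot _)
    | coe D =>
      have h' : ((d * k : ℕ) : ℕ∞) ≤ D + ((d + 1).choose 2 : ℕ) := by exact_mod_cast h
      have h'' : ((k * d - (d + 1).choose 2 : ℕ) : ℕ∞) ≤ D := by
        rw [ENat.natCast_sub, tsub_le_iff_right, mul_comm k d]
        exact h'
      exact WithBot.coe_le_coe.mpr h''
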